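/- Let $T$ be the theory of the random graph (in the language with one binary relation symbol $R$), and let $\mathfrak{C}$ be any $\aleph_1$-saturated model of $T$. Let $\mathbf{E}$ be the class of all finite sets equipped with one equivalence relation and, for $m \ge 1$, let $\mathbf{E}^{*m}$ be the class of all finite sets equipped with $m$ (arbitrary, unrelated) equivalence relations $E_0, \dots, E_{m-1}$; let $\Gamma_m$ denote the Fraïssé limit of $\mathbf{E}^{*m}$. For $n \ge 1$, an $\mathbf{E}^{*m}$-configuration into $\mathfrak{C}^n$ is a function $f : \Gamma_m \to \mathfrak{C}^n$ such that for each $i < m$ there is a first-order formula $\varphi_i(\overline{y}_0, \overline{y}_1)$ with parameters from $\mathfrak{C}$ (where $|\overline{y}_0| = |\overline{y}_1| = n$) satisfying, for all $a, b \in \Gamma_m$, $$\Gamma_m \models E_i(a,b) \iff \mathfrak{C} \models \varphi_i(f(a), f(b)).$$ The $\mathbf{E}$-rank $\mathrm{Rk}_{\mathbf{E}}(n)$ of an $n$-tuple of variables (that is, of the partial type $\overline{y} = \overline{y}$ with $|\overline{y}| = n$) is $m \ge 1$ if there is an $\mathbf{E}^{*m}$-configuration into $\mathfrak{C}^n$ but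 no $\mathbf{E}^{*(m+1)}$-configuration into $\mathfrak{C}^n$; it is $0$ if there is no $\mathbf{E}$-configuration into $\mathfrak{C}^n$, and $\infty$ if there is an $\mathbf{E}^{*m}$-configuration into $\mathfrak{C}^n$ for every $m \ge 1$. Then, for every $n \ge 1$, the $\mathbf{E}$-rank is well defined (exactly one value in $\{0,1,2,\dots,\infty\}$ satisfies its definition), and $$\mathrm{Rk}_{\mathbf{E}}(n) = \begin{cases} 1 & \text{if } n = 1, \\ n^2 - 1 & \text{if } n \ge 2. \end{cases}$$ -/

import Mathlib

open FirstOrder FirstOrder.Language CategoryTheory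

namespace KRank

universe u

/-! ### Free superposition of copies of a class of finite structures -/

/-- The language whose signature is the disjoint union of `m` copies of the signature of `L`. -/
def copies (L : FirstOrder.Language.{0, 0}) (m : ℕ) : FirstOrder.Language.{0, 0} :=
  ⟨fun k => Fin m × L.Functions k, fun k => Fin m × L.Relations k⟩

instance (L : FirstOrder.Language.{0, 0}) [L.IsRelational] (m : ℕ) : (copies L m).IsRelational :=
  fun k => inferInstanceAs (IsEmpty (Fin m × L.Functions k))

/-- The `i`-th copy of `L` inside `copies L m`. -/
def copy (L : FirstOrder.Language.{0, 0}) (m : ℕ) (i : Fin m) : L →ᴸ copies L m :=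
  ⟨fun _ F => (i, F), fun _ R => (i, R)⟩

/-- The `m`-fold free superposition of a class `K` of finite `L`-structures: all finite structures
in `m` disjoint copies of `L` each of whose `m` reducts to `L` belongs to `K`. -/
def superposition {L : FirstOrder.Language.{0, 0}} (K : Set (Bundled.{0} L.Structure)) (m : ℕ) :
    Set (Bundled.{0} (copies L m).Structure) :=
  {A | Finite A ∧ ∀ i : Fin m, (⟨A, (copy L m i).reduct A⟩ : Bundled.{0} L.Structure) ∈ K}

/-! ### Configurations and rank -/

/-- The set of realizations in `C` of a set `p` of `L(C)`-formulas in the variables indexed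
by `α`. -/
def realizations {L : FirstOrder.Language.{0, 0}} {C : Type u} [L.Structure C] {α : Type}
    (p : Set (L[[C]].Formula α)) : Set (α → C) :=
  {v | ∀ φ ∈ p, φ.Realize v}

/-- `f : Γ → p(C)` codes every relation `R` of the `L₀`-structure `Γ` by an `L(C)`-formula. -/
def IsConfiguration {L₀ L : FirstOrder.Language.{0, 0}} (Γ : Type) [L₀.Structure Γ] {C : Type u}
    [L.Structure C] {α : Type} (p : Set (L[[C]].Formula α)) (f : Γ → α → C) : Prop :=
  (∀ a, f a ∈ realizations p) ∧
    ∀ (k : ℕ) (R : L₀.Relations k), ∃ φ : L[[C]].Formula (Fin k × α),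
      ∀ a : Fin k → Γ, Structure.RelMap R a ↔ φ.Realize fun q => f (a q.1) q.2

/-- There is a `K`-configuration into `p`: a configuration whose domain is the
Fraïssé limit `Γ` of `K` (unique up to isomorphism). -/
def HasConfiguration {L₀ L : FirstOrder.Language.{0, 0}} [L₀.IsRelational] (K : Set (Bundled.{0} L₀.Structure))
    {C : Type u} [L.Structure C] {α : Type} (p : Set (L[[C]].Formula α)) : Prop :=
  ∃ (Γ : Type) (_ : L₀.Structure Γ) (_ : Countable Γ), IsFraisseLimit K Γ ∧
    ∃ f : Γ → α → C, IsConfiguration (L₀ := L₀) Γ p f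

/-- `p` has `K`-rank `r`, where `r ∈ {0, 1, 2, …, ∞}`. -/
def HasRank {L₀ L : FirstOrder.Language.{0, 0}} [L₀.IsRelational] (K : Set (Bundled.{0} L₀.Structure))
    {C : Type u} [L.Structure C] {α : Type} (p : Set (L[[C]].Formula α)) (r : ℕ∞) : Prop :=
  (r = 0 ∧ ¬ HasConfiguration (superposition K 1) p) ∨
  (∃ m : ℕ, 1 ≤ m ∧ r = m ∧ HasConfiguration (superposition K m) p ∧
    ¬ HasConfiguration (superposition K (m + 1)) p) ∨
  (r = ⊤ ∧ ∀ m : ℕ, 1 ≤ m → HasConfiguration (superposition K m) p)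

/-- The partial type `y = y`, where `y` is an `n`-tuple of variables. -/
def trivialType (L : FirstOrder.Language.{0, 0}) (C : Type u) [L.Structure C] (n : ℕ) :
    Set (L[[C]].Formula (Fin n)) :=
  Set.range fun i : Fin n => (Term.var i).equal (Term.var i)

/-! ### Finite equivalence relations -/

/-- The single relation symbol, binary, of the language of equivalence relations. -/
inductive EqvRel : ℕ → Type
  | rel : EqvRel 2

/-- The language with one binary relation symbol. -/
def eqvLanguage : FirstOrder.Language.{0, 0} := ⟨fun _ => Empty, EqvRel⟩

instance : eqvLanguage.IsRelational := fun _ => (inferInstance : IsEmpty Empty)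

/-- The class `E` of finite sets with one equivalence relation. -/
def equivalenceRelations : Set (Bundled.{0} eqvLanguage.Structure) :=
  {A | Finite A ∧ Equivalence fun a b : A =>
    Structure.RelMap (L := eqvLanguage) (EqvRel.rel : eqvLanguage.Relations 2) ![a, b]}

/-! ### The theory of the random graph and its saturated models -/

/-- The extension axiom: for all `x₀, …, xₖ₋₁` and `y₀, …, yₗ₋₁` with no `xᵢ` equal to any `yⱼ`,
there is a `z` adjacent to all the `xᵢ`, and adjacent to and equal to none of the `yⱼ`. -/
noncomputable def extensionAxiom (k l : ℕ) : Language.graph.Sentence :=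
  BoundedFormula.alls (n := k + l) <|
    BoundedFormula.imp
      (BoundedFormula.iInf fun q : Fin k × Fin l =>
        ∼ ((&(Fin.castAdd l q.1)) =' (&(Fin.natAdd k q.2))))
      (∃' ((BoundedFormula.iInf fun i : Fin k =>
              adj.boundedFormula₂ (&(Fin.last (k + l))) (&(Fin.castAdd l i).castSucc)) ⊓
           (BoundedFormula.iInf fun j : Fin l =>
              ∼ (adj.boundedFormula₂ (&(Fin.last (k + l))) (&(Fin.natAdd k j).castSucc)) ⊓
              ∼ ((&(Fin.last (k + l))) =' (&(Fin.natAdd k j).castSucc)))))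

/-- The theory of the random graph, axiomatized by the axioms of simple graphs together with
all extension axioms. -/
def randomGraphTheory : Language.graph.Theory :=
  Theory.simpleGraph ∪ {φ | ∃ k l : ℕ, φ = extensionAxiom k l}

theorem realize_extensionAxiom {C : Type u} [Language.graph.Structure C] (k l : ℕ) :
    C ⊨ extensionAxiom k l ↔ ∀ (x : Fin k → C) (y : Fin l → C), (∀ i j, x i ≠ y j) →
      ∃ z, (∀ i, Structure.RelMap adj ![z, x i]) ∧
        ∀ j, ¬ Structure.RelMap adj ![z, y j] ∧ z ≠ y j := by
  rw [extensionAxiom, Sentence.Realize, BoundedFormula.realize_alls]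
  simp only [BoundedFormula.realize_imp, BoundedFormula.realize_iInf, BoundedFormula.realize_ex,
    BoundedFormula.realize_inf, BoundedFormula.realize_not, BoundedFormula.realize_rel₂,
    BoundedFormula.realize_bdEqual, Prod.forall, Function.comp, Term.realize_var, Sum.elim_inr,
    Fin.snoc_last, Fin.snoc_castSucc]
  constructor
  · intro h x y hxy
    obtain ⟨z, h1, h2⟩ := h (Fin.append x y) (by simpa using hxy)
    exact ⟨z, by simpa using h1, by simpa using h2⟩
  · intro h w hw
    obtain ⟨z, h1, h2⟩ := h (fun i => w (Fin.castAdd l i)) (fun j => w (Fin.natAdd k j))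
      (by simpa using hw)
    exact ⟨z, by simpa using h1, by simpa using h2⟩

/-- `M` is `κ`-saturated: every set of formulas in one variable over fewer than `κ` parameters
that is finitely satisfiable in `M` is realized in `M`. -/
def IsSaturated (L : FirstOrder.Language.{0, 0}) (κ : Cardinal.{u}) (M : Type u) [L.Structure M] : Prop :=
  ∀ A : Set M, Cardinal.mk A < κ → ∀ p : Set (L[[A]].Formula (Fin 1)),
    (∀ s : Finset (L[[A]].Formula (Fin 1)), ↑s ⊆ p → ∃ v : Fin 1 → M, ∀ φ ∈ s, φ.Realize v) →
      ∃ v : Fin 1 → M, ∀ φ ∈ p, φ.Realize v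

end KRank

namespace KRank

universe u

/-! ### Partial isomorphisms of the random graph -/

/-! Everything reduces to `hasConfiguration_iff`: a configuration of `m` equivalence relations
exists exactly when `m ≤ graphRank n`. The Fraïssé limit is modelled by a grid: coordinate `i.succ`
names the class of `E_i`, and coordinate `0` separates points that agree in all classes.

Lower bound: a pair of disjoint `n`-tuples has an `n × n` adjacency matrix, which interchanging the
tuples transposes. For `n ≥ 2` there are at least `2 ^ (n ^ 2 - 1)` matrices up to transposition,
and for `n = 1` there are two. So each set of relations holding between two points can get its own
matrix class (`exists_matrices`). The resulting countable graph embeds in the model, and a formula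
reads off the matrix.

Upper bound: by back-and-forth, a formula sees only equality and adjacency among its arguments and
finitely many parameters (`exists_finite_support`). Product Ramsey, applied to large grids inside
the limit, makes everything uniform except the adjacency between different rows
(`le_graphRank_of_grids`). The `2 ^ m` patterns of agreement then need different pair types, even up
to transposition. Types without equalities fill at most three quarters of `2 ^ n ^ 2` when `n ≥ 2`.
An equality at coordinate `j` freezes row and column `j` of the matrix, so these types are too few
to reach `2 ^ n ^ 2` (`le_graphRank_of_pairTypes`). -/

/-- The extension property characterizing the models of the theory of the random graph. -/
def HasExtensionProperty {V : Type*} (G : SimpleGraph V) : Prop :=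
  ∀ X Y : Set V, X.Finite → Y.Finite → Disjoint X Y →
    ∃ z, (∀ x ∈ X, G.Adj z x) ∧ ∀ y ∈ Y, ¬ G.Adj z y ∧ z ≠ y

/-- `P` is the graph of a partial isomorphism of `G`. -/
def IsPartialIso {V : Type*} (G : SimpleGraph V) (P : Set (V × V)) : Prop :=
  ∀ p ∈ P, ∀ q ∈ P, (p.1 = q.1 ↔ p.2 = q.2) ∧ (G.Adj p.1 q.1 ↔ G.Adj p.2 q.2)

theorem IsPartialIso.swap {V : Type*} {G : SimpleGraph V} {P : Set (V × V)}
    (hP : IsPartialIso G P) : IsPartialIso G (Prod.swap '' P) := by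
  rintro _ ⟨p, hp, rfl⟩ _ ⟨q, hq, rfl⟩
  exact ⟨(hP p hp q hq).1.symm, (hP p hp q hq).2.symm⟩

/-- The "forth" step of back-and-forth: a new `x` is sent to a vertex adjacent to exactly those
points of the range that come from neighbours of `x`. -/
theorem IsPartialIso.exists_insert {V : Type*} {G : SimpleGraph V} (hG : HasExtensionProperty G)
    {P : Set (V × V)} (hP : IsPartialIso G P) (hfin : P.Finite) (x : V) :
    ∃ x', IsPartialIso G (insert (x, x') P) := by
  by_cases hx : ∃ p ∈ P, p.1 = x
  · obtain ⟨p, hp, rfl⟩ := hx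
    exact ⟨p.2, by rwa [Set.insert_eq_of_mem hp]⟩
  · push Not at hx
    obtain ⟨z, hzX, hzY⟩ := hG (Prod.snd '' {p ∈ P | G.Adj x p.1})
      (Prod.snd '' {p ∈ P | ¬ G.Adj x p.1}) ((hfin.sep _).image _) ((hfin.sep _).image _) (by
        rw [Set.disjoint_left]
        rintro _ ⟨p, ⟨hp, hpx⟩, rfl⟩ ⟨q, ⟨hq, hqx⟩, h⟩
        rw [(hP q hq p hp).1.2 h] at hqx
        exact hqx hpx)
    have key : ∀ p ∈ P, (z ≠ p.2) ∧ (G.Adj x p.1 ↔ G.Adj z p.2) := fun p hp => by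
      by_cases h : G.Adj x p.1
      · have := hzX p.2 ⟨p, ⟨hp, h⟩, rfl⟩
        exact ⟨this.ne, by simp [h, this]⟩
      · have := hzY p.2 ⟨p, ⟨hp, h⟩, rfl⟩
        exact ⟨this.2, by simp [h, this.1]⟩
    refine ⟨z, ?_⟩
    rintro p (rfl | hp) q (rfl | hq)
    · simp
    · exact ⟨by simp [(hx q hq).symm, (key q hq).1], (key q hq).2⟩
    · exact ⟨by simp [hx p hp, (key p hp).1.symm], by
        simpa only [G.adj_comm] using (key p hp).2⟩
    · exact hP p hp q hq

theorem exists_simpleGraph_of_model {C : Type u} [Language.graph.Structure C]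
    (hT : C ⊨ randomGraphTheory) :
    ∃ G : SimpleGraph C, (∀ x y, G.Adj x y ↔ Structure.RelMap adj ![x, y]) ∧
      HasExtensionProperty G := by
  have h0 : C ⊨ Theory.simpleGraph := hT.mono Set.subset_union_left
  refine ⟨simpleGraphOfStructure C, fun x y => Iff.rfl, fun X Y hX hY hXY => ?_⟩
  obtain ⟨k, x, rfl⟩ := hX.fin_embedding
  obtain ⟨l, y, rfl⟩ := hY.fin_embedding
  have h := (realize_extensionAxiom k l).1
    (hT.realize_of_mem (extensionAxiom k l) (Or.inr ⟨k, l, rfl⟩)) x y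
    (fun i j hij => Set.disjoint_left.1 hXY ⟨i, rfl⟩ ⟨j, hij.symm⟩)
  simpa using h

/-- Finite partial isomorphisms fixing suitable finitely many parameters preserve a given
formula. -/
theorem exists_finite_support {C : Type u} [Language.graph.Structure C] {G : SimpleGraph C}
    (hadj : ∀ x y, G.Adj x y ↔ Structure.RelMap adj ![x, y]) (hG : HasExtensionProperty G)
    {α : Type} {k : ℕ} (φ : Language.graph[[C]].BoundedFormula α k) :
    ∃ A : Set C, A.Finite ∧ ∀ P : Set (C × C), P.Finite → IsPartialIso G P →
      (∀ a ∈ A, (a, a) ∈ P) → ∀ (v v' : α → C) (xs xs' : Fin k → C),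
      (∀ i, (v i, v' i) ∈ P) → (∀ i, (xs i, xs' i) ∈ P) →
      (φ.Realize v xs ↔ φ.Realize v' xs') := by
  have term : ∀ {k : ℕ} (t : Language.graph[[C]].Term (α ⊕ Fin k)), ∃ A : Set C, A.Finite ∧
      ∀ P : Set (C × C), (∀ a ∈ A, (a, a) ∈ P) → ∀ (v v' : α → C) (xs xs' : Fin k → C),
      (∀ i, (v i, v' i) ∈ P) → (∀ i, (xs i, xs' i) ∈ P) →
      (t.realize (Sum.elim v xs), t.realize (Sum.elim v' xs')) ∈ P := by
    intro k t
    cases t with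
    | var i =>
      refine ⟨∅, Set.finite_empty, fun P _ v v' xs xs' hv hxs => ?_⟩
      cases i with
      | inl i => exact hv i
      | inr i => exact hxs i
    | @func l f ts =>
      rcases f with f | f
      · exact isEmptyElim f
      · rcases l with _ | l
        · refine ⟨{f}, Set.finite_singleton _, fun P hA v v' xs xs' hv hxs => ?_⟩
          exact hA f rfl
        · exact isEmptyElim f
  induction φ with
  | falsum => exact ⟨∅, Set.finite_empty, fun _ _ _ _ _ _ _ _ _ _ => Iff.rfl⟩
  | equal t₁ t₂ =>
    obtain ⟨A, hA, h₁⟩ := term t₁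
    obtain ⟨B, hB, h₂⟩ := term t₂
    refine ⟨A ∪ B, hA.union hB, fun P hP hiso hAP v v' xs xs' hv hxs => ?_⟩
    exact (hiso _ (h₁ P (fun a ha => hAP a (Or.inl ha)) v v' xs xs' hv hxs) _
      (h₂ P (fun a ha => hAP a (Or.inr ha)) v v' xs xs' hv hxs)).1
  | @rel k l R ts =>
    rcases R with R | R
    · cases R
      obtain ⟨A, hA, h₁⟩ := term (ts 0)
      obtain ⟨B, hB, h₂⟩ := term (ts 1)
      refine ⟨A ∪ B, hA.union hB, fun P hP hiso hAP v v' xs xs' hv hxs => ?_⟩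
      have := (hiso _ (h₁ P (fun a ha => hAP a (Or.inl ha)) v v' xs xs' hv hxs) _
        (h₂ P (fun a ha => hAP a (Or.inr ha)) v v' xs xs' hv hxs)).2
      rw [hadj, hadj] at this
      have e : ∀ w : α ⊕ Fin k → C, (fun i => (ts i).realize w) =
          ![(ts 0).realize w, (ts 1).realize w] := fun w => by
        ext i; fin_cases i <;> rfl
      simp only [BoundedFormula.Realize]
      rw [e, e]
      exact this
    · exact isEmptyElim R
  | imp φ ψ hφ hψ =>
    obtain ⟨A, hA, h₁⟩ := hφ
    obtain ⟨B, hB, h₂⟩ := hψ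
    refine ⟨A ∪ B, hA.union hB, fun P hP hiso hAP v v' xs xs' hv hxs => ?_⟩
    exact imp_congr (h₁ P hP hiso (fun a ha => hAP a (Or.inl ha)) v v' xs xs' hv hxs)
      (h₂ P hP hiso (fun a ha => hAP a (Or.inr ha)) v v' xs xs' hv hxs)
  | @all k φ hφ =>
    obtain ⟨A, hA, h₁⟩ := hφ
    refine ⟨A, hA, ?_⟩
    -- One direction suffices, since the inverse of a partial isomorphism is one too.
    have key : ∀ P : Set (C × C), P.Finite → IsPartialIso G P →
        (∀ a ∈ A, (a, a) ∈ P) → ∀ (v v' : α → C) (xs xs' : Fin k → C),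
        (∀ i, (v i, v' i) ∈ P) → (∀ i, (xs i, xs' i) ∈ P) →
        (φ.all.Realize v' xs' → φ.all.Realize v xs) := by
      intro P hP hiso hAP v v' xs xs' hv hxs h x
      obtain ⟨x', hx'⟩ := hiso.exists_insert hG hP x
      refine (h₁ _ (hP.insert _) hx' (fun a ha => Or.inr (hAP a ha)) v v' (Fin.snoc xs x)
        (Fin.snoc xs' x') (fun i => Or.inr (hv i)) (fun i => ?_)).2 (h x')
      refine Fin.lastCases ?_ (fun i => ?_) i
      · simp
      · simpa using Or.inr (hxs i)
    refine fun P hP hiso hAP v v' xs xs' hv hxs => ⟨?_, key P hP hiso hAP v v' xs xs' hv hxs⟩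
    exact key _ (hP.image _) hiso.swap (fun a ha => ⟨_, hAP a ha, rfl⟩) v' v xs' xs
      (fun i => ⟨_, hv i, rfl⟩) (fun i => ⟨_, hxs i, rfl⟩)

/-! ### Ramsey's theorem for products of pairs -/

/-- Large finite sets contain long sequences that are end-homogeneous for a coloring of pairs. -/
theorem exists_endHomogeneous (κ : Type*) [Fintype κ] (l : ℕ) :
    ∃ N : ℕ, ∀ {α : Type} (c : α → α → κ) (X : Finset α), N ≤ X.card →
      ∃ (x : Fin l → α) (e : Fin l → κ), Function.Injective x ∧ (∀ i, x i ∈ X) ∧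
        ∀ i j, i < j → c (x i) (x j) = e i := by
  classical
  induction l with
  | zero =>
    exact ⟨0, fun c X _ => ⟨Fin.elim0, Fin.elim0, fun i => i.elim0, fun i => i.elim0,
      fun i => i.elim0⟩⟩
  | succ l ih =>
    obtain ⟨N, hN⟩ := ih
    -- One extra element is the head `a` that gets removed; the other makes the pigeonhole
    -- inequality strict.
    refine ⟨Fintype.card κ * N + 1 + 1, fun {α} c X hX => ?_⟩
    obtain ⟨a, ha⟩ : X.Nonempty := Finset.card_pos.1 (by omega)
    have hcard : (Finset.univ : Finset κ).card * N < (X.erase a).card := by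
      rw [Finset.card_erase_of_mem ha, Finset.card_univ]; omega
    obtain ⟨col, -, hcol⟩ := Finset.exists_lt_card_fiber_of_mul_lt_card_of_maps_to
      (f := c a) (fun _ _ => Finset.mem_univ _) hcard
    obtain ⟨x, e, hx, hxX, hxe⟩ := hN c _ hcol.le
    have hmem : ∀ i, x i ≠ a ∧ x i ∈ X ∧ c a (x i) = col := fun i => by
      simpa [and_assoc] using hxX i
    refine ⟨Fin.cons a x, Fin.cons col e, ?_, ?_, ?_⟩
    · rw [Fin.cons_injective_iff]
      exact ⟨fun ⟨i, hi⟩ => (hmem i).1 hi, hx⟩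
    · intro i
      cases i using Fin.cases with
      | zero => exact ha
      | succ i => exact (hmem i).2.1
    · intro i j hij
      cases j using Fin.cases with
      | zero => exact absurd hij (Fin.not_lt_zero _)
      | succ j =>
        cases i using Fin.cases with
        | zero => exact (hmem j).2.2
        | succ i => simpa using hxe i j (Fin.succ_lt_succ_iff.1 hij)

/-- Ramsey's theorem for pairs. -/
theorem exists_homogeneous (κ : Type*) [Fintype κ] (s : ℕ) :
    ∃ N : ℕ, ∀ c : Fin N → Fin N → κ, ∃ (x : Fin s → Fin N) (col : κ),
      Function.Injective x ∧ ∀ i j, i < j → c (x i) (x j) = col := by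
  classical
  obtain ⟨N, hN⟩ := exists_endHomogeneous κ (Fintype.card κ * s + 1)
  refine ⟨N, fun c => ?_⟩
  obtain ⟨x, e, hx, -, hxe⟩ := hN c Finset.univ (by simp)
  obtain ⟨col, -, hcol⟩ := Finset.exists_lt_card_fiber_of_mul_lt_card_of_maps_to
    (s := Finset.univ) (t := Finset.univ) (f := e) (n := s) (fun _ _ => Finset.mem_univ _) (by simp)
  obtain ⟨Y, hY, hYs⟩ := Finset.exists_subset_card_eq hcol.le
  refine ⟨fun i => x (Y.orderEmbOfFin hYs i), col,
    hx.comp (Y.orderEmbOfFin hYs).injective, fun i j hij => ?_⟩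
  rw [hxe _ _ ((Y.orderEmbOfFin hYs).strictMono hij)]
  exact (Finset.mem_filter.1 (hY (Y.orderEmbOfFin_mem hYs i))).2

/-- The product Ramsey theorem for pairs: a coloring of the boxes of a large grid is constant on the
boxes of some subgrid with sides of length `s`. -/
theorem exists_homogeneous_grid (κ : Type*) [Fintype κ] (s d : ℕ) :
    ∃ N : ℕ, ∀ c : (Fin d → Fin N) → (Fin d → Fin N) → κ,
      ∃ (x : Fin d → Fin s → Fin N) (col : κ), (∀ i, Function.Injective (x i)) ∧
        ∀ u v : Fin d → Fin s, (∀ i, u i < v i) →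
          c (fun i => x i (u i)) (fun i => x i (v i)) = col := by
  classical
  induction d with
  | zero =>
    exact ⟨0, fun c => ⟨Fin.elim0, c Fin.elim0 Fin.elim0, fun i => i.elim0, fun u v _ =>
      congr_arg₂ c (Subsingleton.elim _ _) (Subsingleton.elim _ _)⟩⟩
  | succ d ih =>
    obtain ⟨N, hN⟩ := ih
    -- A pair of first coordinates is coloured by the whole coloring it induces on the remaining
    -- grid.
    obtain ⟨M, hM⟩ := exists_homogeneous ((Fin d → Fin N) → (Fin d → Fin N) → κ) s
    refine ⟨max N M, fun c => ?_⟩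
    let iN : Fin N → Fin (max N M) := Fin.castLE (le_max_left _ _)
    let iM : Fin M → Fin (max N M) := Fin.castLE (le_max_right _ _)
    obtain ⟨y, c', hy, hyc⟩ := hM fun p q a b => c (Fin.cons (iM p) (iN ∘ a))
      (Fin.cons (iM q) (iN ∘ b))
    obtain ⟨x, col, hx, hxc⟩ := hN c'
    refine ⟨Fin.cons (iM ∘ y) (fun i => iN ∘ x i), col, ?_, fun u v huv => ?_⟩
    · intro i
      cases i using Fin.cases with
      | zero => exact (Fin.castLE_injective (le_max_right N M)).comp hy
      | succ i => exact (Fin.castLE_injective (le_max_left N M)).comp (hx i)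
    · rw [← hxc (fun i => u i.succ) (fun i => v i.succ) (fun i => huv i.succ),
        ← hyc (u 0) (v 0) (huv 0)]
      congr 1 <;> (ext i; cases i using Fin.cases <;> rfl)

/-! ### Counting pair types -/

/-- The rank of an `n`-tuple of variables in the random graph. -/
def graphRank (n : ℕ) : ℕ := if n = 1 then 1 else n ^ 2 - 1

theorem card_matrices (J : Type*) [Fintype J] [DecidableEq J] :
    Fintype.card (J → J → Bool) = 2 ^ Fintype.card J ^ 2 := by
  simp [sq, pow_mul]

open Classical in
/-- In a family of matrices that are pairwise distinct up to transposition, every member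
counts twice, unless it is symmetric. -/
theorem two_mul_card_le_of_injective_up_to_transpose {ι J : Type*} [Fintype ι] [Fintype J]
    (M : ι → J → J → Bool) (hM : ∀ s t, M s = M t → s = t)
    (hM' : ∀ s t, (∀ j k, M s j k = M t k j) → s = t) :
    2 * Fintype.card ι ≤ Fintype.card (J → J → Bool) +
      Fintype.card {A : J → J → Bool // ∀ j k, A j k = A k j} := by
  rw [mul_comm, ← Fintype.card_bool, ← Fintype.card_prod, ← Fintype.card_sum]
  -- The second copy of a member goes to its transpose or, if that is the same matrix, to the
  -- separate summand of symmetric matrices.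
  let F : ι × Bool → (J → J → Bool) ⊕ {A : J → J → Bool // ∀ j k, A j k = A k j} := fun x =>
    if x.2 then .inl (M x.1) else
      if h : ∀ j k, M x.1 j k = M x.1 k j then .inr ⟨M x.1, h⟩ else .inl fun j k => M x.1 k j
  refine Fintype.card_le_of_injective F ?_
  have key : ∀ s t, F (s, true) ≠ F (t, false) := by
    intro s t h
    simp only [F, if_true, Bool.false_eq_true, if_false] at h
    split_ifs at h with hs
    have hst : s = t := hM' s t fun j k => by rw [Sum.inl.inj h]
    subst hst
    exact hs fun j k => by conv_lhs => rw [Sum.inl.inj h]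
  rintro ⟨s, _ | _⟩ ⟨t, _ | _⟩ h
  · simp only [F, Bool.false_eq_true, if_false] at h
    split_ifs at h with hs ht ht
    · rw [hM s t (by simpa using h)]
    · rw [hM s t]
      ext j k
      exact congrFun (congrFun (Sum.inl.inj h) k) j
  · exact absurd h.symm (key t s)
  · exact absurd h (key s t)
  · rw [hM s t (by simpa [F] using h)]

-- In a symmetric matrix the entry at `(a, b)` can be overwritten by an arbitrary bit without loss,
-- as it is still readable at `(b, a)`.
open Classical in
theorem two_mul_card_symmetric_le {J : Type*} [Fintype J] (hJ : 2 ≤ Fintype.card J) :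
    2 * Fintype.card {A : J → J → Bool // ∀ j k, A j k = A k j} ≤
      Fintype.card (J → J → Bool) := by
  obtain ⟨a, b, hab⟩ := Fintype.one_lt_card_iff.1 hJ
  rw [mul_comm, ← Fintype.card_bool, ← Fintype.card_prod]
  refine Fintype.card_le_of_injective (fun x : {A : J → J → Bool // ∀ j k, A j k = A k j} × Bool =>
    fun j k => if j = a ∧ k = b then x.2 else x.1.1 j k) ?_
  rintro ⟨⟨A, hA⟩, s⟩ ⟨⟨B, hB⟩, t⟩ h
  have h' : ∀ j k, (if j = a ∧ k = b then s else A j k) = if j = a ∧ k = b then t else B j k :=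
    fun j k => congrFun (congrFun h j) k
  have hst : s = t := by simpa using h' a b
  have hba : A b a = B b a := by simpa [hab.symm] using h' b a
  subst hst
  congr 2
  ext j k
  by_cases hjk : j = a ∧ k = b
  · rw [hjk.1, hjk.2, hA, hB, hba]
  · simpa [hjk] using h' j k

/-- A nonempty family of finite sets closed under subsets and unions is a power set. -/
theorem exists_card_eq_two_pow {α : Type*} [DecidableEq α] {Q : Finset (Finset α)}
    (hne : Q.Nonempty) (hsub : ∀ S ∈ Q, ∀ T ⊆ S, T ∈ Q) (hun : ∀ S ∈ Q, ∀ T ∈ Q, S ∪ T ∈ Q) :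
    ∃ s, Q.card = 2 ^ s := by
  have hmem : Q.sup id ∈ Q := by
    obtain ⟨T, hT⟩ := hne
    refine Finset.sup_induction (p := (· ∈ Q)) (hsub T hT _ (Finset.empty_subset _)) hun
      fun S hS => hS
  refine ⟨(Q.sup id).card, ?_⟩
  rw [← Finset.card_powerset]
  congr 1
  ext S
  rw [Finset.mem_powerset]
  exact ⟨fun hS => Finset.le_sup (f := id) hS, fun hS => hsub _ hmem _ hS⟩

/-- Bounds the number of equivalence relations coded by a family of pair types over a finite index
set `J`: `e T j` records equality, and `M T j k` adjacency, of coordinates in the type `T`. -/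
theorem le_graphRank_of_pairTypes {J : Type} [Fintype J] [Nonempty J] {m : ℕ}
    (e : Finset (Fin m) → J → Bool) (M : Finset (Fin m) → J → J → Bool) (M₀ : J → J → Bool)
    (hinj : ∀ S T, (∀ j, e S j = e T j) → (∀ j k, M S j k = M T j k) → S = T)
    (hswap : ∀ S T, (∀ j, e S j = e T j) → (∀ j k, M S j k = M T k j) → S = T)
    (hsub : ∀ S T j, T ⊆ S → e S j = true → e T j = true)
    (hun : ∀ S T j, e S j = true → e T j = true → e (S ∪ T) j = true)
    (hrow : ∀ T j k, e T j = true → M T j k = M₀ j k)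
    (hcol : ∀ T j k, e T k = true → M T j k = M₀ j k)
    (hirr : ∀ j, M₀ j j = false) :
    m ≤ graphRank (Fintype.card J) := by
  classical
  set n := Fintype.card J with hn
  have hn0 : 0 < n := Fintype.card_pos
  let Q : J → Finset (Finset (Fin m)) := fun j => Finset.univ.filter fun T => e T j = true
  let N : Finset (Finset (Fin m)) := Finset.univ.filter fun T => ∀ j, e T j = false
  have hQ0 : ∀ j, (Q j).Nonempty → ∅ ∈ Q j := fun j ⟨T, hT⟩ => by
    simp only [Q, Finset.mem_filter, Finset.mem_univ, true_and] at hT ⊢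
    exact hsub T ∅ j (Finset.empty_subset _) hT
  -- the pair types without equalities
  have hN : 2 * N.card ≤ 2 ^ n ^ 2 +
      Fintype.card {A : J → J → Bool // ∀ j k, A j k = A k j} := by
    rw [hn, ← card_matrices, ← Fintype.card_coe]
    have hf : ∀ s t : N, ∀ j, e s.1 j = e t.1 j := fun s t j => by
      rw [(Finset.mem_filter.1 s.2).2 j, (Finset.mem_filter.1 t.2).2 j]
    refine two_mul_card_le_of_injective_up_to_transpose (fun T : N => M T.1) ?_ ?_
    · exact fun s t h => Subtype.ext (hinj _ _ (hf s t) fun j k => by simp only [h])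
    · exact fun s t h => Subtype.ext (hswap _ _ (hf s t) h)
  -- the pair types with an equality at `j`
  let code : (j : J) → Q j → ({k // k ≠ j} → Bool) × ({k // k ≠ j} → {k // k ≠ j} → Bool) :=
    fun j T => (fun k => e T.1 k, fun k l => M T.1 k l)
  have hcode : ∀ j, Function.Injective (code j) := by
    intro j S T h
    have hS : e S.1 j = true := (Finset.mem_filter.1 S.2).2
    have hT : e T.1 j = true := (Finset.mem_filter.1 T.2).2
    have h₁ : ∀ k (hk : k ≠ j), e S.1 k = e T.1 k := fun k hk =>
      congrFun (congrArg Prod.fst h) ⟨k, hk⟩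
    have h₂ : ∀ k (hk : k ≠ j) l (hl : l ≠ j), M S.1 k l = M T.1 k l := fun k hk l hl =>
      congrFun (congrFun (congrArg Prod.snd h) ⟨k, hk⟩) ⟨l, hl⟩
    -- Row and column `j` are dictated by `M₀`, so only the `(n - 1) + (n - 1) ^ 2` bits away from
    -- `j` are free.
    refine Subtype.ext (hinj _ _ (fun k => ?_) fun k l => ?_)
    · by_cases hk : k = j
      · rw [hk, hS, hT]
      · exact h₁ k hk
    · by_cases hk : k = j
      · rw [hk, hrow _ _ _ hS, hrow _ _ _ hT]
      · by_cases hl : l = j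
        · rw [hl, hcol _ _ _ hS, hcol _ _ _ hT]
        · exact h₂ k hk l hl
  have hcodeCard : ∀ j : J, Fintype.card
      (({k // k ≠ j} → Bool) × ({k // k ≠ j} → {k // k ≠ j} → Bool)) = 2 ^ (n * (n - 1)) := by
    intro j
    have hc : Fintype.card {k // k ≠ j} = n - 1 := by
      rw [Fintype.card_subtype_compl, Fintype.card_subtype_eq]
    obtain ⟨k, hk⟩ : ∃ k, n = k + 1 := ⟨n - 1, by omega⟩
    rw [Fintype.card_prod, card_matrices, Fintype.card_fun, hc, Fintype.card_bool, ← pow_add, hk]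
    congr 1
    simp only [Nat.add_sub_cancel]
    ring
  -- every pair type is of one of these kinds
  have htotal : 2 ^ m ≤ N.card + (1 + ∑ j, ((Q j).card - 1)) := by
    -- `∅` lies in every nonempty `Q j`; it is counted only once, and this saving gives strictness
    -- in the final estimate.
    have hcover : (Finset.univ : Finset (Finset (Fin m))) ⊆
        N ∪ ({∅} ∪ Finset.univ.biUnion fun j => (Q j).erase ∅) := by
      intro T _
      by_cases hT : T ∈ N
      · exact Finset.mem_union_left _ hT
      · simp only [N, Finset.mem_filter, Finset.mem_univ, true_and, not_forall,
          Bool.not_eq_false] at hT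
        obtain ⟨j, hj⟩ := hT
        by_cases hT0 : T = ∅
        · simp [hT0]
        · refine Finset.mem_union_right _ (Finset.mem_union_right _ (Finset.mem_biUnion.2
            ⟨j, Finset.mem_univ _, Finset.mem_erase.2 ⟨hT0, ?_⟩⟩))
          simp [Q, hj]
    calc 2 ^ m = (Finset.univ : Finset (Finset (Fin m))).card := by simp
      _ ≤ _ := Finset.card_le_card hcover
      _ ≤ N.card + (Finset.card {∅} + (Finset.univ.biUnion fun j => (Q j).erase ∅).card) :=
        (Finset.card_union_le _ _).trans (Nat.add_le_add_left (Finset.card_union_le _ _) _)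
      _ ≤ N.card + (1 + ∑ j, ((Q j).card - 1)) := by
        refine Nat.add_le_add_left (Nat.add_le_add (by simp) ?_) _
        refine Finset.card_biUnion_le.trans (Finset.sum_le_sum fun j _ => ?_)
        rcases (Q j).eq_empty_or_nonempty with h | h
        · simp [h]
        · rw [Finset.card_erase_of_mem (hQ0 j h)]
  by_contra hlt
  push Not at hlt
  rcases Nat.lt_or_ge n 2 with hn2 | hn2
  · have hn1 : n = 1 := by omega
    have hQ : ∀ j, (Q j).card - 1 = 0 := fun j => by
      have := Fintype.card_le_of_injective _ (hcode j)
      rw [hcodeCard, Fintype.card_coe, hn1] at this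
      exact Nat.sub_eq_zero_of_le (by simpa using this)
    have hsym : Fintype.card {A : J → J → Bool // ∀ j k, A j k = A k j} ≤ 2 := by
      refine (Fintype.card_subtype_le _).trans ?_
      rw [card_matrices, ← hn, hn1]; norm_num
    -- For `n = 1` the total is at most `2 + 1 + 0 < 4`.
    have hm2 : 2 ^ 2 ≤ 2 ^ m := Nat.pow_le_pow_right (by norm_num) (by
      rw [hn1, graphRank, if_pos rfl] at hlt; exact hlt)
    simp only [hQ, Finset.sum_const_zero] at htotal
    rw [hn1] at hN
    norm_num at hN hm2
    omega
  · have hsym := two_mul_card_symmetric_le (J := J) (by omega)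
    rw [card_matrices, ← hn] at hsym
    have hQ : ∀ j, (Q j).card - 1 ≤ 2 ^ (n * (n - 1) - 1) - 1 := by
      intro j
      refine Nat.sub_le_sub_right ?_ 1
      rcases (Q j).eq_empty_or_nonempty with h | h
      · simp [h]
      -- The all-true code is not attained: equality at a second coordinate `k` would force a loop
      -- at `k`. As `(Q j).card` is a power of two, missing one code halves the bound.
      have hlt : (Q j).card < 2 ^ (n * (n - 1)) := by
        rw [← hcodeCard j, ← Fintype.card_coe]
        refine Fintype.card_lt_of_injective_not_surjective _ (hcode j) fun hs => ?_
        obtain ⟨T, hT⟩ := hs (fun _ => true, fun _ _ => true)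
        obtain ⟨k, hk⟩ := Fintype.exists_ne_of_one_lt_card (by omega : 1 < Fintype.card J) j
        have h₁ : e T.1 k = true := congrFun (congrArg Prod.fst hT) ⟨k, hk⟩
        have h₂ : M T.1 k k = true := congrFun (congrFun (congrArg Prod.snd hT) ⟨k, hk⟩) ⟨k, hk⟩
        rw [hrow _ _ _ h₁, hirr] at h₂
        exact Bool.false_ne_true h₂
      obtain ⟨s, hs⟩ := exists_card_eq_two_pow h
        (fun S hS T hTS => by
          simp only [Q, Finset.mem_filter, Finset.mem_univ, true_and] at hS ⊢
          exact hsub S T j hTS hS)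
        (fun S hS T hT => by
          simp only [Q, Finset.mem_filter, Finset.mem_univ, true_and] at hS hT ⊢
          exact hun S T j hS hT)
      rw [hs] at hlt ⊢
      have := (Nat.pow_lt_pow_iff_right (by norm_num)).1 hlt
      exact Nat.pow_le_pow_right (by norm_num) (by omega)
    have hsum : ∑ j, ((Q j).card - 1) ≤ n * (2 ^ (n * (n - 1) - 1) - 1) := by
      refine (Finset.sum_le_sum fun j _ => hQ j).trans ?_
      simp [hn]
    -- With `K = 2 ^ n ^ 2`: `N.card ≤ 3K/4` and the sum is at most `K/4 - n`, so `2 ^ m ≤ K + 1 - n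
    -- < K`, a contradiction.
    have hm : 2 ^ n ^ 2 ≤ 2 ^ m := Nat.pow_le_pow_right (by norm_num) (by
      rw [graphRank, if_neg (by omega)] at hlt; omega)
    have hnn : 1 ≤ n * (n - 1) := Nat.mul_pos (by omega) (by omega)
    have hK : 2 ^ n ^ 2 = 2 * 2 ^ (n - 1) * (2 * 2 ^ (n * (n - 1) - 1)) := by
      rw [← pow_succ', ← pow_succ', ← pow_add]
      congr 1
      obtain ⟨k, hk⟩ : ∃ k, n = k + 1 := ⟨n - 1, by omega⟩
      have : n * (n - 1) - 1 + 1 = n * (n - 1) := by omega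
      rw [this, hk]; simp only [Nat.add_sub_cancel]; ring
    have hpow : n ≤ 2 ^ (n - 1) := by
      have := (n - 1).lt_two_pow_self
      omega
    have hle : n * 2 ^ (n * (n - 1) - 1) ≤ 2 ^ (n - 1) * 2 ^ (n * (n - 1) - 1) :=
      Nat.mul_le_mul_right _ hpow
    have hsub' : n * (2 ^ (n * (n - 1) - 1) - 1) = n * 2 ^ (n * (n - 1) - 1) - n := by
      rw [Nat.mul_sub, mul_one]
    have hK' : 2 ^ n ^ 2 = 4 * (2 ^ (n - 1) * 2 ^ (n * (n - 1) - 1)) := by rw [hK]; ring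
    have : n ≤ n * 2 ^ (n * (n - 1) - 1) := Nat.le_mul_of_pos_right _ (by positivity)
    omega

/-! ### Arrays of vertices with canonical equality patterns -/

/-- The array `h` of vertices of `G`, indexed by a grid, is canonical: its rows are injective with
a constant adjacency pattern, equality between the rows of `a ≤ b` depends only on where
`a` and `b` differ, and pairs of rows with the same pattern have equal coordinates `i.succ` at the
same `i`. -/
structure IsCanonicalArray {V J : Type*} (G : SimpleGraph V) {m : ℕ}
    (h : (Fin (m + 1) → Fin 3) → J → V) : Prop where
  injective : ∀ a, Function.Injective (h a)
  adj_iff : ∀ a b j k, G.Adj (h a j) (h a k) ↔ G.Adj (h b j) (h b k)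
  eq_iff : ∀ a b a' b' : Fin (m + 1) → Fin 3,
    (∀ i, a i < b i ∧ a' i < b' i ∨ a i = b i ∧ a' i = b' i) →
      ∀ j k, h a j = h b k ↔ h a' j = h b' k
  coord_eq_iff : ∀ a b a' b' : Fin (m + 1) → Fin 3,
    (∀ j k, (h a j = h b k ↔ h a' j = h b' k) ∧
      (G.Adj (h a j) (h b k) ↔ G.Adj (h a' j) (h b' k))) →
    ∀ i : Fin m, a i.succ = b i.succ ↔ a' i.succ = b' i.succ

namespace IsCanonicalArray

/-- The point of the grid with coordinates `1` on `U` and `0` elsewhere. -/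
def point {d : ℕ} (U : Finset (Fin d)) (i : Fin d) : Fin 3 := if i ∈ U then 1 else 0

variable {V J : Type*} {G : SimpleGraph V} {m : ℕ} {h : (Fin (m + 1) → Fin 3) → J → V}

/-- Moving the upper point from `1` to `2` on `U` keeps the pattern, so both upper points carry the
same vertex at `k`. Hence so do `0` and `point U`, and injectivity of the row at `0` applies. -/
theorem eq_of_eq (hh : IsCanonicalArray G h) {U : Finset (Fin (m + 1))} {j k : J}
    (e : h 0 j = h (point U) k) : j = k := by
  let b : Fin (m + 1) → Fin 3 := fun i => if i ∈ U then 2 else 0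
  have e₁ : h 0 j = h b k := (hh.eq_iff 0 (point U) 0 b (fun i => by
    by_cases hi : i ∈ U <;> simp [point, b, hi]) j k).1 e
  have e₂ : h 0 k = h (point U) k := (hh.eq_iff (point U) b 0 (point U) (fun i => by
    by_cases hi : i ∈ U <;> simp [point, b, hi]) k k).1 (e.symm.trans e₁)
  exact hh.injective 0 (e.trans e₂.symm)

/-- An intermediate point, raised to `2` on `U'`, has the same pattern over `0` as `point U` has,
while over `point U` it differs only on `U'`. -/
theorem eq_of_subset (hh : IsCanonicalArray G h) {U U' : Finset (Fin (m + 1))} (hU : U' ⊆ U)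
    {j : J} (e : h 0 j = h (point U) j) : h 0 j = h (point U') j := by
  let b : Fin (m + 1) → Fin 3 := fun i => if i ∈ U' then 2 else point U i
  have e₁ : h 0 j = h b j := (hh.eq_iff 0 (point U) 0 b (fun i => by
    by_cases hi : i ∈ U
    · by_cases hi' : i ∈ U' <;> simp [point, b, hi, hi']
    · have hi' : i ∉ U' := fun hi' => hi (hU hi')
      simp [point, b, hi, hi']) j j).1 e
  exact (hh.eq_iff (point U) b 0 (point U') (fun i => by
    by_cases hi' : i ∈ U'
    · simp [point, b, hi', hU hi']
    · simp [point, b, hi']) j j).1 (e.symm.trans e₁)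

/-- Equality is transported in two steps: from `0` to `point U`, then by the pattern `U' \ U` up to
the union. -/
theorem eq_union (hh : IsCanonicalArray G h) {U U' : Finset (Fin (m + 1))} {j : J}
    (e : h 0 j = h (point U) j) (e' : h 0 j = h (point U') j) :
    h 0 j = h (point (U ∪ U')) j := by
  have e₁ := hh.eq_of_subset (Finset.sdiff_subset (s := U') (t := U)) e'
  exact e.trans ((hh.eq_iff 0 (point (U' \ U)) (point U) (point (U ∪ U')) (fun i => by
    by_cases hi : i ∈ U
    · simp [point, hi]
    · by_cases hi' : i ∈ U' <;> simp [point, hi, hi']) j j).1 e₁)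

/-- A canonical array with finite nonempty rows codes at most `graphRank` equivalence relations. -/
theorem le_graphRank {J : Type} [Fintype J] [Nonempty J] {h : (Fin (m + 1) → Fin 3) → J → V}
    (hh : IsCanonicalArray G h) : m ≤ graphRank (Fintype.card J) := by
  classical
  -- `0` and `point (up T)` differ at coordinate `0` and at the coordinates named by `T`, so `T` is
  -- the set of relations that fail.
  let up : Finset (Fin m) → Finset (Fin (m + 1)) := fun T => insert 0 (T.map (Fin.succEmb m))
  have hup : ∀ T (i : Fin m), (0 : Fin (m + 1) → Fin 3) i.succ = point (up T) i.succ ↔ i ∉ T :=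
    fun T i => by by_cases hi : i ∈ T <;> simp [point, up, hi]
  have ext_of : ∀ S T, (∀ i : Fin m, (0 : Fin (m + 1) → Fin 3) i.succ = point (up S) i.succ ↔
      (0 : Fin (m + 1) → Fin 3) i.succ = point (up T) i.succ) → S = T := by
    intro S T hST
    ext i
    exact not_iff_not.1 (by rw [← hup, ← hup, hST i])
  have offdiag : ∀ T j k, j ≠ k → ¬ h 0 j = h (point (up T)) k := fun T j k hjk e =>
    hjk (hh.eq_of_eq e)
  refine le_graphRank_of_pairTypes (J := J) (fun T j => decide (h 0 j = h (point (up T)) j))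
    (fun T j k => decide (G.Adj (h 0 j) (h (point (up T)) k)))
    (fun j k => decide (G.Adj (h 0 j) (h 0 k))) ?_ ?_ ?_ ?_ ?_ ?_ ?_
  · intro S T he hM
    refine ext_of S T (hh.coord_eq_iff _ _ _ _ fun j k => ⟨?_, by simpa using hM j k⟩)
    by_cases hjk : j = k
    · subst hjk; simpa using he j
    · simp [offdiag S j k hjk, offdiag T j k hjk]
  · intro S T he hM
    refine ext_of S T fun i => (hh.coord_eq_iff 0 _ (point (up T)) 0 (fun j k => ⟨?_, ?_⟩) i).trans
      eq_comm
    · by_cases hjk : j = k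
      · subst hjk; simpa [eq_comm] using he j
      · exact iff_of_false (offdiag S j k hjk) fun e => offdiag T k j (Ne.symm hjk) e.symm
    · simpa [G.adj_comm] using hM j k
  · intro S T j hTS he
    simp only [decide_eq_true_eq] at he ⊢
    exact hh.eq_of_subset (Finset.insert_subset_insert _ (Finset.map_subset_map.2 hTS)) he
  · intro S T j hS hT
    simp only [decide_eq_true_eq] at hS hT ⊢
    have := hh.eq_union hS hT
    have e : up S ∪ up T = up (S ∪ T) := by
      ext i; simp only [up, Finset.map_union, Finset.mem_union, Finset.mem_insert]; tauto
    rwa [e] at this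
  · intro T j k he
    simp only [decide_eq_true_eq] at he
    simp only [he]
    simpa using hh.adj_iff (point (up T)) 0 j k |>.trans (by rw [he])
  · intro T j k he
    simp only [decide_eq_true_eq] at he
    simp only [he]
  · simp

end IsCanonicalArray

theorem graphRank_mono {k n : ℕ} (hk : 1 ≤ k) (hkn : k ≤ n) : graphRank k ≤ graphRank n := by
  unfold graphRank
  have h : k ^ 2 ≤ n ^ 2 := Nat.pow_le_pow_left hkn 2
  split_ifs with h₁ h₂ h₂
  · exact le_rfl
  · have : 2 ^ 2 ≤ n ^ 2 := Nat.pow_le_pow_left (by omega) 2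
    omega
  · omega
  · omega

/-- Large finite grids of `n`-tuples in which partial isomorphisms over finitely many parameters
preserve `m` coordinate equalities exist only for `m ≤ graphRank n`. -/
theorem le_graphRank_of_grids {V : Type*} (G : SimpleGraph V) {A : Set V} (hA : A.Finite)
    {n m : ℕ} (hn : 1 ≤ n)
    (H : ∀ N : ℕ, ∃ f : (Fin (m + 1) → Fin N) → Fin n → V, ∀ a b a' b',
      IsPartialIso G ((fun e => (e, e)) '' A ∪
        (Set.range (fun j => (f a j, f a' j)) ∪ Set.range (fun j => (f b j, f b' j)))) →
      ∀ i : Fin m, a i.succ = b i.succ ↔ a' i.succ = b' i.succ) :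
    m ≤ graphRank n := by
  classical
  have := hA.fintype
  obtain ⟨N, hN⟩ := exists_homogeneous_grid
    ((Fin n → A → Prop) × (Fin n → A → Prop) × (Fin n → Fin n → Prop) × (Fin n → Fin n → Prop) ×
      (Finset (Fin (m + 1)) → Fin n → Fin n → Prop)) 4 (m + 1)
  obtain ⟨f, hf⟩ := H N
  -- The `piecewise` component also colours pairs that agree off `U`, which a box with all sides
  -- strict does not see directly. Adjacency between different rows is left uncoloured: it must
  -- carry the coding.
  obtain ⟨x, col, hx, hcol⟩ := hN fun a b =>
    (fun j e => f a j = e, fun j e => G.Adj (f a j) e, fun j k => f a j = f a k,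
      fun j k => G.Adj (f a j) (f a k), fun U j k => f a j = f (U.piecewise b a) k)
  -- The fourth value is held back, so that every point of the subgrid is the lower corner of some
  -- box.
  let sub : (Fin (m + 1) → Fin 3) → Fin (m + 1) → Fin N := fun a i => x i (a i).castSucc
  let g : (Fin (m + 1) → Fin 3) → Fin n → V := fun a => f (sub a)
  have hvert := fun a b : Fin (m + 1) → Fin 3 =>
    (hcol (fun i => (a i).castSucc) (fun _ => Fin.last 3) (fun i => Fin.castSucc_lt_last _)).trans
    (hcol (fun i => (b i).castSucc) (fun _ => Fin.last 3) (fun i => Fin.castSucc_lt_last _)).symm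
  simp only [Prod.mk.injEq] at hvert hcol
  have v₁ : ∀ a b j, ∀ e ∈ A, g a j = e ↔ g b j = e := fun a b j e he =>
    iff_of_eq (congrFun (congrFun (hvert a b).1 j) ⟨e, he⟩)
  have v₂ : ∀ a b j, ∀ e ∈ A, G.Adj (g a j) e ↔ G.Adj (g b j) e := fun a b j e he =>
    iff_of_eq (congrFun (congrFun (hvert a b).2.1 j) ⟨e, he⟩)
  have v₃ : ∀ a b j k, g a j = g a k ↔ g b j = g b k := fun a b j k =>
    iff_of_eq (congrFun (congrFun (hvert a b).2.2.1 j) k)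
  have v₄ : ∀ a b j k, G.Adj (g a j) (g a k) ↔ G.Adj (g b j) (g b k) := fun a b j k =>
    iff_of_eq (congrFun (congrFun (hvert a b).2.2.2.1 j) k)
  have hpair' : ∀ (U : Finset (Fin (m + 1))) (a b : Fin (m + 1) → Fin 3),
      (∀ i, i ∈ U ∧ a i < b i ∨ i ∉ U ∧ a i = b i) → ∀ j k,
        (g a j = g b k) = col.2.2.2.2 U j k := by
    intro U a b hab j k
    let y : Fin (m + 1) → Fin 4 := fun i => if i ∈ U then (b i).castSucc else Fin.last 3
    have h := hcol (fun i => (a i).castSucc) y (fun i => by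
      rcases hab i with ⟨hi, hlt⟩ | ⟨hi, -⟩
      · simpa [y, hi] using hlt
      · simp only [y, if_neg hi]
        exact Fin.castSucc_lt_last _)
    rw [← h]
    have e : U.piecewise (fun i => x i (y i)) (fun i => x i (a i).castSucc) = sub b := by
      ext i
      rcases hab i with ⟨hi, -⟩ | ⟨hi, hi'⟩
      · simp [y, hi, sub]
      · simp [hi, sub, hi']
    change _ = (f (sub a) j = f _ k)
    rw [e]
  have hpair : ∀ a b a' b' : Fin (m + 1) → Fin 3,
      (∀ i, a i < b i ∧ a' i < b' i ∨ a i = b i ∧ a' i = b' i) →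
      ∀ j k, g a j = g b k ↔ g a' j = g b' k := by
    intro a b a' b' hab j k
    let U : Finset (Fin (m + 1)) := Finset.univ.filter fun i => a i < b i
    have h₁ := hpair' U a b (fun i => by
      rcases hab i with h | h
      · exact Or.inl ⟨by simp [U, h.1], h.1⟩
      · exact Or.inr ⟨by simp [U, h.1], h.1⟩) j k
    have h₂ := hpair' U a' b' (fun i => by
      rcases hab i with h | h
      · exact Or.inl ⟨by simp [U, h.1], h.2⟩
      · exact Or.inr ⟨by simp [U, h.1], h.2⟩) j k
    rw [h₁, h₂]
  -- By `v₃`, coordinates equal in one row are equal in all; merging them makes rows injective, and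
  -- the shorter length is harmless by `graphRank_mono`.
  let s : Setoid (Fin n) :=
    { r := fun j k => ∀ a, g a j = g a k
      iseqv := ⟨fun j a => rfl, fun h a => (h a).symm, fun h h' a => (h a).trans (h' a)⟩ }
  have : Nonempty (Quotient s) := ⟨Quotient.mk s ⟨0, hn⟩⟩
  let h : (Fin (m + 1) → Fin 3) → Quotient s → V := fun a =>
    Quotient.lift (g a) (fun j k hjk => hjk a)
  have hcan : IsCanonicalArray G h := by
    refine ⟨fun a => ?_, fun a b => ?_, fun a b a' b' hab => ?_, fun a b a' b' hab i => ?_⟩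
    · rintro ⟨j⟩ ⟨k⟩ hjk
      exact Quotient.sound fun b => (v₃ a b j k).1 hjk
    · rintro ⟨j⟩ ⟨k⟩
      exact v₄ a b j k
    · rintro ⟨j⟩ ⟨k⟩
      exact hpair a b a' b' hab j k
    -- Types over `A` and within a row are the same for all rows, so agreement of the cross pattern
    -- already gives a partial isomorphism.
    · have key := hf (sub a) (sub b) (sub a') (sub b') ?_ i
      · have hinj : ∀ a b : Fin (m + 1) → Fin 3,
            sub a i.succ = sub b i.succ ↔ a i.succ = b i.succ := fun a b =>
          (hx i.succ).eq_iff.trans Fin.castSucc_inj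
        rwa [hinj, hinj] at key
      have hab' : ∀ j k, (g a j = g b k ↔ g a' j = g b' k) ∧
          (G.Adj (g a j) (g b k) ↔ G.Adj (g a' j) (g b' k)) :=
        fun j k => hab (Quotient.mk s j) (Quotient.mk s k)
      have hAv : ∀ a a' : Fin (m + 1) → Fin 3, ∀ e ∈ A, ∀ j,
          (e = g a j ↔ e = g a' j) ∧ (G.Adj e (g a j) ↔ G.Adj e (g a' j)) := fun a a' e he j => by
        rw [eq_comm, v₁ a a' j e he, G.adj_comm, v₂ a a' j e he, G.adj_comm, eq_comm]
        exact ⟨Iff.rfl, Iff.rfl⟩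
      have symm : ∀ p q : V × V, (p.1 = q.1 ↔ p.2 = q.2) ∧ (G.Adj p.1 q.1 ↔ G.Adj p.2 q.2) →
          (q.1 = p.1 ↔ q.2 = p.2) ∧ (G.Adj q.1 p.1 ↔ G.Adj q.2 p.2) := fun p q hpq => by
        simpa only [eq_comm, G.adj_comm] using hpq
      rintro _ (⟨e, he, rfl⟩ | ⟨j, rfl⟩ | ⟨j, rfl⟩) _ (⟨e', he', rfl⟩ | ⟨k, rfl⟩ | ⟨k, rfl⟩)
      · exact ⟨Iff.rfl, Iff.rfl⟩
      · exact hAv a a' e he k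
      · exact hAv b b' e he k
      · exact symm (e', e') (g a j, g a' j) (hAv a a' e' he' j)
      · exact ⟨v₃ a a' j k, v₄ a a' j k⟩
      · exact hab' j k
      · exact symm (e', e') (g b j, g b' j) (hAv b b' e' he' j)
      · exact symm (g a k, g a' k) (g b j, g b' j) (hab' k j)
      · exact ⟨v₃ b b' j k, v₄ b b' j k⟩
  refine hcan.le_graphRank.trans (graphRank_mono Fintype.card_pos ?_)
  simpa using Fintype.card_quotient_le s

/-! ### Grids and the Fraïssé limit of `m` equivalence relations -/

/-- Points with `m + 1` coordinates in `S`. -/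
def Grid (m : ℕ) (S : Type) : Type := Fin (m + 1) → S

/-- The symbol for the `i`-th equivalence relation. -/
def eqvSymbol {m : ℕ} (i : Fin m) : (copies eqvLanguage m).Relations 2 := (i, EqvRel.rel)

/-- On a grid, the `i`-th equivalence relation is equality of the coordinates `i.succ`. -/
instance (m : ℕ) (S : Type) : (copies eqvLanguage m).Structure (Grid m S) where
  funMap F _ := isEmptyElim F
  RelMap {k} R := match k, R with
    | _, (i, EqvRel.rel) => fun x => x 0 i.succ = x 1 i.succ

theorem forall_relations {m : ℕ} {p : ∀ k, (copies eqvLanguage m).Relations k → Prop} :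
    (∀ k R, p k R) ↔ ∀ i : Fin m, p 2 (eqvSymbol i) :=
  ⟨fun h i => h 2 _, fun h k R => by
    rcases R with ⟨i, R⟩
    cases R
    exact h i⟩

theorem relMap_grid {m : ℕ} {S : Type} (i : Fin m) (x : Fin 2 → Grid m S) :
    Structure.RelMap (eqvSymbol i) x ↔ x 0 i.succ = x 1 i.succ := Iff.rfl

theorem mem_superposition_iff {m : ℕ} {A : Bundled.{0} (copies eqvLanguage m).Structure} :
    A ∈ superposition equivalenceRelations m ↔ Finite A ∧
      ∀ i : Fin m, Equivalence fun a b : A => Structure.RelMap (eqvSymbol i) ![a, b] :=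
  ⟨fun h => ⟨h.1, fun i => (h.2 i).2⟩, fun h => ⟨h.1, fun i => ⟨h.1, h.2 i⟩⟩⟩

theorem grid_mem_superposition (m : ℕ) (S : Type) [Finite S] :
    (⟨Grid m S, inferInstance⟩ : Bundled.{0} (copies eqvLanguage m).Structure) ∈
      superposition equivalenceRelations m :=
  mem_superposition_iff.2 ⟨inferInstanceAs (Finite (Fin (m + 1) → S)), fun _ =>
    ⟨fun _ => rfl, fun h => Eq.symm h, fun h h' => Eq.trans h h'⟩⟩

theorem exists_perm_extending {ι : Type} [Finite ι] (u v : ι → ℕ)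
    (h : ∀ x y, u x = u y ↔ v x = v y) : ∃ π : ℕ ≃ ℕ, ∀ x, π (u x) = v x := by
  choose r hr using fun y : Set.range u => y.2
  obtain ⟨π, hπ⟩ := Cardinal.extend_function_of_lt (s := Set.range u)
    ⟨fun y => v (r y), fun y z hyz => Subtype.ext (by rw [← hr y, ← hr z]; exact (h _ _).2 hyz)⟩
    (by
      rw [Cardinal.mk_nat]
      exact (Set.finite_range u).lt_aleph0) ⟨Equiv.refl ℕ⟩
  exact ⟨π, fun x => (hπ ⟨u x, x, rfl⟩).trans ((h _ _).1 (hr ⟨u x, x, rfl⟩))⟩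

/-- A finite partial isomorphism acts on each class coordinate as a finite injection, extended to a
permutation `π i`. Coordinate `0` is then permuted separately over each tuple of classes. -/
theorem grid_isUltrahomogeneous (m : ℕ) :
    IsUltrahomogeneous (copies eqvLanguage m) (Grid m ℕ) := by
  intro S hS f
  have : Finite S := ((Substructure.fg_iff_structure_fg S).1 hS).finite
  have hrel : ∀ (i : Fin m) (a b : S), a.1 i.succ = b.1 i.succ ↔ f a i.succ = f b i.succ :=
    fun i a b => (f.map_rel (eqvSymbol i) ![a, b]).symm
  choose π hπ using fun i : Fin m => exists_perm_extending (fun a : S => a.1 i.succ)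
    (fun a : S => f a i.succ) (hrel i)
  have hfib : ∀ c : Fin m → ℕ, ∃ σ : ℕ ≃ ℕ, ∀ a : S, (fun i : Fin m => a.1 i.succ) = c →
      σ (a.1 0) = f a 0 := by
    intro c
    obtain ⟨σ, hσ⟩ := exists_perm_extending
      (ι := {a : S // (fun i : Fin m => a.1 i.succ) = c})
      (fun a => a.1.1 0) (fun a => f a.1 0) (fun a b => by
        have htail : ∀ i : Fin m, a.1.1 i.succ = b.1.1 i.succ := fun i =>
          congrFun (a.2.trans b.2.symm) i
        constructor
        · intro h
          have : a.1.1 = b.1.1 := funext fun i => Fin.cases h htail i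
          rw [Subtype.ext this]
        · intro h
          have : f a.1 = f b.1 := funext fun i => Fin.cases h (fun i => (hrel i _ _).1 (htail i)) i
          rw [f.injective this])
    exact ⟨σ, fun a ha => hσ ⟨a, ha⟩⟩
  choose σ hσ using hfib
  let g : Grid m ℕ ≃ Grid m ℕ :=
    { toFun := fun a => Fin.cons (σ (fun i => a i.succ) (a 0)) fun i => π i (a i.succ)
      invFun := fun b => Fin.cons ((σ fun i => (π i).symm (b i.succ)).symm (b 0))
        fun i => (π i).symm (b i.succ)
      left_inv := fun a => funext fun i => by cases i using Fin.cases <;> simp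
      right_inv := fun b => funext fun i => by cases i using Fin.cases <;> simp }
  refine ⟨⟨g, fun F => isEmptyElim F, ?_⟩, ?_⟩
  · intro k R
    revert k R
    rw [forall_relations]
    intro i x
    exact (π i).injective.eq_iff
  · ext a
    refine funext fun i => ?_
    cases i using Fin.cases with
    | zero => exact (hσ _ a rfl).symm
    | succ i => exact (hπ i a).symm

theorem grid_age (m : ℕ) :
    (copies eqvLanguage m).age (Grid m ℕ) = superposition equivalenceRelations m := by
  ext A
  rw [mem_superposition_iff]
  constructor
  · rintro ⟨hA, ⟨f⟩⟩
    refine ⟨hA.finite, fun i => ?_⟩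
    have hrel : ∀ a b : A, Structure.RelMap (eqvSymbol i) ![a, b] ↔ f a i.succ = f b i.succ :=
      fun a b => (f.map_rel (eqvSymbol i) ![a, b]).symm
    simp only [hrel]
    exact ⟨fun _ => rfl, fun h => h.symm, fun h h' => h.trans h'⟩
  · rintro ⟨hA, hE⟩
    obtain ⟨c, hc⟩ := Countable.exists_injective_nat A
    choose d hd using fun i => Countable.exists_injective_nat (Quotient (Setoid.mk _ (hE i)))
    refine ⟨Structure.FG.of_finite, ⟨⟨⟨fun a => Fin.cons (c a) fun i => d i (Quotient.mk _ a),
      fun a b hab => hc (congrFun hab 0)⟩, fun F => isEmptyElim F, ?_⟩⟩⟩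
    intro k R
    revert k R
    rw [forall_relations]
    intro i x
    have hx : x = ![x 0, x 1] := by ext j; fin_cases j <;> rfl
    refine (hd i).eq_iff.trans (Quotient.eq.trans ?_)
    conv_rhs => rw [hx]
    rfl

theorem grid_isFraisseLimit (m : ℕ) [Countable (Grid m ℕ)] :
    IsFraisseLimit (superposition equivalenceRelations m) (Grid m ℕ) :=
  ⟨grid_isUltrahomogeneous m, grid_age m⟩

theorem HasConfiguration.le_graphRank {C : Type u} [Language.graph.Structure C]
    (hT : C ⊨ randomGraphTheory) {n m : ℕ} (hn : 1 ≤ n)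
    (h : HasConfiguration (superposition equivalenceRelations m)
      (trivialType Language.graph C n)) : m ≤ graphRank n := by
  obtain ⟨G, hadj, hG⟩ := exists_simpleGraph_of_model hT
  obtain ⟨Γ, _, _, hΓ, f, -, hf⟩ := h
  choose φ hφ using fun i : Fin m => hf 2 (eqvSymbol i)
  choose A hA hAφ using fun i => exists_finite_support hadj hG (φ i)
  refine le_graphRank_of_grids G (Set.finite_iUnion hA) hn fun N => ?_
  have hmem := grid_mem_superposition m (Fin N)
  rw [← hΓ.age] at hmem
  obtain ⟨-, ⟨ε⟩⟩ := hmem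
  refine ⟨fun a => f (ε a), fun a b a' b' hP i => ?_⟩
  have hcode : ∀ a b : Grid m (Fin N), a i.succ = b i.succ ↔
      (φ i).Realize fun q => f (![ε a, ε b] q.1) q.2 := fun a b => by
    have h₁ := ε.map_rel (eqvSymbol i) ![a, b]
    have h₂ : (ε ∘ ![a, b]) = ![ε a, ε b] := by ext j; fin_cases j <;> rfl
    rw [h₂] at h₁
    exact h₁.symm.trans (hφ i _)
  refine (hcode a b).trans (Iff.trans ?_ (hcode a' b').symm)
  refine hAφ i _ ?_ hP (fun e he => Or.inl ⟨e, Set.mem_iUnion.2 ⟨i, he⟩, rfl⟩) _ _ _ _ ?_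
    (fun j => j.elim0)
  · exact ((Set.finite_iUnion hA).image _).union ((Set.finite_range _).union (Set.finite_range _))
  · rintro ⟨j, k⟩
    fin_cases j
    · exact Or.inr (Or.inl ⟨k, rfl⟩)
    · exact Or.inr (Or.inr ⟨k, rfl⟩)

/-! ### Coding equivalence relations by pair types -/

/-- Vertices are chosen greedily, each with the prescribed adjacencies to its predecessors. -/
theorem HasExtensionProperty.exists_embedding_nat {V : Type*} {G : SimpleGraph V}
    (hG : HasExtensionProperty G) (H : SimpleGraph ℕ) :
    ∃ g : ℕ → V, Function.Injective g ∧ ∀ u v, G.Adj (g u) (g v) ↔ H.Adj u v := by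
  have step : ∀ (n : ℕ) (prev : ∀ k, k < n → V), ∃ z,
      (∀ k l hk hl, prev k hk = prev l hl → k = l) →
        ∀ k hk, (G.Adj z (prev k hk) ↔ H.Adj n k) ∧ z ≠ prev k hk := by
    intro n prev
    by_cases hinj : ∀ k l hk hl, prev k hk = prev l hl → k = l
    · have hfin : ∀ p : Fin n → Prop, ((fun k : Fin n => prev k k.2) '' {k | p k}).Finite :=
        fun p => Set.toFinite _
      obtain ⟨z, hX, hY⟩ := hG _ _ (hfin fun k => H.Adj n k) (hfin fun k => ¬ H.Adj n k) (by
        rw [Set.disjoint_left]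
        rintro _ ⟨k, hk, rfl⟩ ⟨l, hl, h⟩
        exact hl (hinj _ _ _ _ h ▸ hk))
      refine ⟨z, fun _ k hk => ?_⟩
      by_cases h : H.Adj n k
      · have := hX _ ⟨⟨k, hk⟩, h, rfl⟩
        exact ⟨iff_of_true this h, this.ne⟩
      · have := hY _ ⟨⟨k, hk⟩, h, rfl⟩
        exact ⟨iff_of_false this.1 h, this.2⟩
    -- A default vertex for non-injective histories, which the recursion never produces.
    · obtain ⟨z, -, -⟩ := hG ∅ ∅ Set.finite_empty Set.finite_empty (by simp)
      exact ⟨z, fun h => absurd h hinj⟩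
  choose next hnext using step
  let g : ℕ → V := WellFounded.fix Nat.lt_wfRel.wf next
  have hg : ∀ n, g n = next n fun k _ => g k := fun n => WellFounded.fix_eq _ _ _
  have key : ∀ n, ∀ k < n, (G.Adj (g n) (g k) ↔ H.Adj n k) ∧ g n ≠ g k := by
    intro n
    induction n using Nat.strong_induction_on with
    | _ n ih =>
      rw [hg n]
      refine hnext n _ fun k l hk hl h => ?_
      rcases lt_trichotomy k l with hkl | hkl | hkl
      · exact absurd h.symm (ih l hl k hkl).2
      · exact hkl
      · exact absurd h (ih k hk l hkl).2
  refine ⟨g, fun u v h => ?_, fun u v => ?_⟩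
  · rcases lt_trichotomy u v with huv | huv | huv
    · exact absurd h.symm (key v u huv).2
    · exact huv
    · exact absurd h (key u v huv).2
  · rcases lt_trichotomy u v with huv | huv | huv
    · rw [G.adj_comm, H.adj_comm, (key v u huv).1]
    · simp [huv]
    · exact (key u v huv).1

theorem HasExtensionProperty.exists_embedding {V W : Type*} [Countable W] {G : SimpleGraph V}
    (hG : HasExtensionProperty G) (H : SimpleGraph W) :
    ∃ g : W → V, Function.Injective g ∧ ∀ u v, G.Adj (g u) (g v) ↔ H.Adj u v := by
  obtain ⟨c⟩ := nonempty_embedding_nat W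
  obtain ⟨g, hg, hgH⟩ := hG.exists_embedding_nat (H.map c)
  exact ⟨g ∘ c, hg.comp c.injective, fun u v => (hgH _ _).trans SimpleGraph.map_adj_apply⟩

/-- There are `2 ^ m` matrices pairwise distinct up to transposition if `m ≤ graphRank n`. -/
theorem exists_matrices {n m : ℕ} (hn : 1 ≤ n) (hm : m ≤ graphRank n) :
    ∃ M : (Fin m → Bool) → Fin n → Fin n → Bool, (∀ s t, M s = M t → s = t) ∧
      ∀ s t, (∀ j k, M s j k = M t k j) → s = t := by
  classical
  let S : Setoid (Fin n → Fin n → Bool) :=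
    { r := fun A B => A = B ∨ ∀ j k, A j k = B k j
      iseqv :=
        { refl := fun A => Or.inl rfl
          symm := by
            rintro A B (rfl | h)
            · exact Or.inl rfl
            · exact Or.inr fun j k => (h k j).symm
          trans := by
            rintro A B D (rfl | h) (rfl | h')
            · exact Or.inl rfl
            · exact Or.inr h'
            · exact Or.inr h
            · exact Or.inl (funext₂ fun j k => (h j k).trans (h' k j)) } }
  have hcard : 2 ^ m ≤ Fintype.card (Quotient S) := by
    have hmat := card_matrices (Fin n)
    rw [Fintype.card_fin] at hmat
    by_cases h1 : n = 1
    · subst h1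
      have hinj : Function.Injective (Quotient.mk S) := fun A B h => by
        rcases Quotient.exact h with h | h
        · exact h
        · funext j k
          rw [h, Subsingleton.elim j k]
      refine le_trans ?_ (Fintype.card_le_of_injective _ hinj)
      rw [hmat]
      exact Nat.pow_le_pow_right (by norm_num) hm
    -- Each matrix is its class representative or the transpose of it, so classes number at least
    -- half the matrices.
    · have hsurj : Function.Surjective fun x : Quotient S × Bool =>
          if x.2 then x.1.out else fun j k => x.1.out k j := by
        intro A
        rcases Quotient.mk_out (s := S) A with h | h
        · exact ⟨(Quotient.mk S A, true), h⟩
        · exact ⟨(Quotient.mk S A, false), funext₂ fun j k => h k j⟩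
      have := Fintype.card_le_of_surjective _ hsurj
      rw [hmat, Fintype.card_prod, Fintype.card_bool] at this
      have h2 : 2 ^ m ≤ 2 ^ (n ^ 2 - 1) := Nat.pow_le_pow_right (by norm_num) (by
        rwa [graphRank, if_neg h1] at hm)
      have h3 : 2 ^ n ^ 2 = 2 ^ (n ^ 2 - 1) * 2 := by
        rw [← pow_succ, Nat.sub_add_cancel (Nat.pow_pos hn)]
      omega
  obtain ⟨ε⟩ := Function.Embedding.nonempty_of_card_le (α := Fin m → Bool) (β := Quotient S)
    (by simpa using hcard)
  refine ⟨fun t => (ε t).out, fun s t h => ε.injective (Quotient.out_injective h),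
    fun s t h => ε.injective ?_⟩
  rw [← Quotient.out_eq (ε s), ← Quotient.out_eq (ε t)]
  exact Quotient.sound (Or.inr h)

/-- The formula expressing that the adjacency matrix between two `n`-tuples is `A`. -/
noncomputable def matrixFormula (C : Type u) {n : ℕ} (A : Fin n → Fin n → Bool) :
    Language.graph[[C]].Formula (Fin 2 × Fin n) :=
  Formula.iInf fun q : Fin n × Fin n =>
    let φ : Language.graph[[C]].Formula (Fin 2 × Fin n) :=
      Relations.formula₂ ((lhomWithConstants Language.graph C).onRelation adj)
        (Term.var (0, q.1)) (Term.var (1, q.2))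
    if A q.1 q.2 then φ else ∼φ

theorem realize_matrixFormula {C : Type u} [Language.graph.Structure C] {n : ℕ}
    (A : Fin n → Fin n → Bool) (v : Fin 2 × Fin n → C) :
    (matrixFormula C A).Realize v ↔
      ∀ j k, Structure.RelMap adj ![v (0, j), v (1, k)] ↔ A j k = true := by
  rw [matrixFormula, Formula.realize_iInf, Prod.forall]
  refine forall₂_congr fun j k => ?_
  have hrel : (Relations.formula₂ ((lhomWithConstants Language.graph C).onRelation adj)
      (Term.var (0, j)) (Term.var (1, k))).Realize v ↔
      Structure.RelMap adj ![v (0, j), v (1, k)] :=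
    Formula.realize_rel₂
  cases h : A j k
  · simpa [h] using not_congr hrel
  · simpa [h] using hrel

theorem hasConfiguration_of_le_graphRank {C : Type u} [Language.graph.Structure C]
    (hT : C ⊨ randomGraphTheory) {n m : ℕ} (hn : 1 ≤ n) (hm : m ≤ graphRank n) :
    HasConfiguration (superposition equivalenceRelations m)
      (trivialType Language.graph C n) := by
  classical
  obtain ⟨G, hadj, hG⟩ := exists_simpleGraph_of_model hT
  obtain ⟨M, hM, hM'⟩ := exists_matrices hn hm
  have : Countable (Grid m ℕ) := inferInstanceAs (Countable (Fin (m + 1) → ℕ))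
  obtain ⟨c, hc⟩ := Countable.exists_injective_nat (Grid m ℕ)
  let t : Grid m ℕ → Grid m ℕ → Fin m → Bool := fun a b i => decide (a i.succ = b i.succ)
  have ht : ∀ a b, t a b = t b a := fun a b => by simp only [t, eq_comm]
  -- The enumeration `c` orients each pair of rows, deciding which of a matrix and its transpose is
  -- used; rows have no inner edges.
  let H : SimpleGraph (Grid m ℕ × Fin n) :=
    { Adj := fun x y => c x.1 < c y.1 ∧ M (t x.1 y.1) x.2 y.2 = true ∨
        c y.1 < c x.1 ∧ M (t x.1 y.1) y.2 x.2 = true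
      symm := ⟨fun x y h => by rw [ht y.1 x.1]; exact h.symm⟩
      loopless := ⟨fun x h => by simp at h⟩ }
  obtain ⟨g, hg, hgH⟩ := hG.exists_embedding H
  refine ⟨Grid m ℕ, inferInstance, inferInstance, grid_isFraisseLimit m, fun a j => g (a, j),
    fun a => ?_, ?_⟩
  · rintro _ ⟨i, rfl⟩
    simp
  rw [forall_relations]
  intro i
  -- The formula cannot see the order `c`, so it admits both orientations of each matrix coding
  -- agreement at `i`. Distinctness up to transposition keeps this unambiguous, and the first
  -- disjunct handles equal points.
  refine ⟨(Formula.iInf fun k : Fin n => (Term.var (0, k)).equal (Term.var (1, k))) ⊔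
    Formula.iSup fun s : {s : Fin m → Bool // s i = true} =>
      matrixFormula C (M s.1) ⊔ matrixFormula C fun j k => M s.1 k j, fun x => ?_⟩
  rw [relMap_grid, Formula.realize_sup, Formula.realize_iInf, Formula.realize_iSup]
  simp only [Formula.realize_sup, realize_matrixFormula, ← hadj, hgH, Formula.realize_equal,
    Term.realize_var]
  generalize x 0 = a
  generalize x 1 = b
  have hi : a i.succ = b i.succ ↔ t a b i = true := by simp [t]
  rcases lt_trichotomy (c a) (c b) with hab | hab | hab
  · have hne : ¬ ∀ k : Fin n, g (a, k) = g (b, k) := fun h => by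
      have := congrArg Prod.fst (hg (h ⟨0, hn⟩))
      simp only at this
      rw [this] at hab
      exact lt_irrefl _ hab
    simp only [H, hab, hab.not_gt, hne, true_and, false_and, or_false, false_or,
      Bool.coe_iff_coe, hi]
    constructor
    · exact fun h => ⟨⟨t a b, h⟩, Or.inl fun j k => rfl⟩
    · rintro ⟨⟨s, hs⟩, h | h⟩
      · rwa [hM _ s (funext₂ h)]
      · rwa [hM' _ s h]
  · have hab' := hc hab
    subst hab'
    simp
  · have hne : ¬ ∀ k : Fin n, g (a, k) = g (b, k) := fun h => by
      have := congrArg Prod.fst (hg (h ⟨0, hn⟩))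
      simp only at this
      rw [this] at hab
      exact lt_irrefl _ hab
    simp only [H, hab, hab.not_gt, hne, true_and, false_and, false_or,
      Bool.coe_iff_coe, hi]
    constructor
    · exact fun h => ⟨⟨t a b, h⟩, Or.inr fun j k => rfl⟩
    · rintro ⟨⟨s, hs⟩, h | h⟩
      · rwa [hM' _ s fun j k => h k j]
      · rwa [hM _ s (funext₂ fun j k => h k j)]

theorem hasConfiguration_iff {C : Type u} [Language.graph.Structure C]
    (hT : C ⊨ randomGraphTheory) {n m : ℕ} (hn : 1 ≤ n) :
    HasConfiguration (superposition equivalenceRelations m)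
      (trivialType Language.graph C n) ↔ m ≤ graphRank n :=
  ⟨fun h => h.le_graphRank hT hn, hasConfiguration_of_le_graphRank hT hn⟩

end KRank

theorem mainTheorem4 {C : Type*} [Language.graph.Structure C]
    (hT : C ⊨ KRank.randomGraphTheory)
    (hC : KRank.IsSaturated Language.graph (Cardinal.aleph 1) C)
    (n : ℕ) (hn : 1 ≤ n) (r : ℕ∞) :
    KRank.HasRank KRank.equivalenceRelations (KRank.trivialType Language.graph C n) r ↔
      r = if n = 1 then 1 else ((n ^ 2 - 1 : ℕ) : ℕ∞) := by
  have hrank : (if n = 1 then 1 else ((n ^ 2 - 1 : ℕ) : ℕ∞)) = (KRank.graphRank n : ℕ∞) := by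
    unfold KRank.graphRank
    split_ifs <;> simp
  have hpos : 1 ≤ KRank.graphRank n := KRank.graphRank_mono le_rfl hn
  rw [hrank, KRank.HasRank]
  simp only [KRank.hasConfiguration_iff hT hn]
  constructor
  · rintro (⟨-, h⟩ | ⟨m, -, rfl, h, h'⟩ | ⟨-, h⟩)
    · exact absurd hpos h
    · rw [show m = KRank.graphRank n by omega]
    · have := h (KRank.graphRank n + 1) (by omega)
      omega
  · rintro rfl
    exact Or.inr (Or.inl ⟨_, hpos, rfl, le_rfl, by omega⟩)
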